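/- **Parameters.** An even rational parameter is a rational $p/q\in(0,1)$ in lowest terms with $pq$ even. Put $\omega=p+q$, $P=2p/\omega$, $Q=2q/\omega$. Its tune is the unique integer $\tau\in(0,\omega/2)$ with $2p\tau\equiv\pm1 \pmod\omega$, and $\kappa\ge 0$ is the integer with $$\frac{\kappa}{2\kappa+1}\le\frac{\tau}{\omega}<\frac{\kappa+1}{2(\kappa+1)+1}.$$ An even predecessor of $p/q$ is an even rational parameter $p'/q'$ (so $0<p'/q'<1$) with $|p'q-pq'|=1$ and $p'+q'<p+q$; when it exists it is unique (it exists exactly when $p\ge2$), and then the core predecessor of $p/q$ is $\hat p/\hat q$ with $\hat p=p-2\kappa p'$, $\hat q=q-2\kappa q'$. Put $\hat\omega=\hat p+\hat q$. **Plaid tiling.** Let $[\cdot]_2$ denote the representative mod $2\mathbb Z$ in $[-1,1)$, and put $F_H(x,y)=[2Py]_2$, $F_V(x,y)=[2Px]_2$, $F_P(x,y)=[Py+P^2x+1]_2$, $F_Q(x,y)=[Py+PQx+1]_2$. Let $\mathcal H$ and $\mathcal V$ be the families of lines $y=n$ and $x=n$ ($n\in\mathbb Z$), and let $\mathcal P$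 and $\mathcal Q$ be the families of lines with integer $y$-intercept and slope $-P$ and $-Q$ respectively. For $A\in\{H,V\}$, a point $z$ on an $\mathcal A$-line is light (with respect to that line) if, for some $B\in\{P,Q\}$, $z$ lies on a $\mathcal B$-line, $|F_B(z)|<|F_A(z)|$ and $F_A(z)F_B(z)>0$. An edge of a unit square with integer vertices is good if it (as a closed segment) contains exactly one point that is light with respect to the horizontal or vertical line containing the edge, where a light point that is the midpoint of a horizontal edge is counted twice. The plaid tiling $\Pi_{p/q}\subset\mathbb R^2$ is the union, over all unit squares with integer vertices, of the segments joining the center of the square to the centers of its good edges. **Box.** The capacity of the line $x=m$ ($m\in\mathbb Z$) is $|\omega F_V(m,\cdot)|$. Let $R_{p/q}=[0,w]\times[0,\omega]$, where $w$ is the least positive integer such that the line $x=w$ has positive capacity at most $4$. **Lemma (Core Copying).** Let $p/q$ be an even rational parameter with $\kappa\ge1$ that has an even predecessor, and let $\hat p/\hat q$ be its core predecessor. Let $\Upsilon(x,y)=\bigl(x,\;y+\tfrac{\omega-\hat\omega}{2}\bigr)$, $\hat\Sigma=R_{\hat p/\hat q}$ and $\Sigma=\Upsilon(\hat\Sigma)$.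 Then $$\Sigma\cap\Pi_{p/q}=\Upsilon\bigl(\hat\Sigma\cap\Pi_{\hat p/\hat q}\bigr).$$ -/

import Mathlib

namespace Plaid

/-! ## Parameters -/

/-- `p / q` is an even rational parameter: a rational in `(0, 1)`, written in lowest terms,
with `p * q` even. -/
structure IsEvenParameter (p q : ℤ) : Prop where
  pos : 0 < p
  lt : p < q
  coprime : IsCoprime p q
  even : Even (p * q)

/-- `τ` is the tune of `p / q`: the solution in `(0, ω / 2)` of `2 p τ ≡ ± 1 mod ω`,
where `ω = p + q`. -/
def IsTune (p q τ : ℤ) : Prop :=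
  0 < τ ∧ 2 * τ < p + q ∧ (2 * p * τ ≡ 1 [ZMOD (p + q)] ∨ 2 * p * τ ≡ -1 [ZMOD (p + q)])

/-- `p' / q'` is the even predecessor of `p / q`: both are even rational parameters, they are
Farey related, and `ω' < ω`. -/
def IsEvenPredecessor (p' q' p q : ℤ) : Prop :=
  IsEvenParameter p' q' ∧ IsEvenParameter p q ∧ |p' * q - p * q'| = 1 ∧ p' + q' < p + q

/-- `κ ≥ 0` is the integer with `κ / (2κ + 1) ≤ τ / ω < (κ + 1) / (2 (κ + 1) + 1)`. -/
def IsKappa (p q κ : ℤ) : Prop :=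
  0 ≤ κ ∧ ∃ τ : ℤ, IsTune p q τ ∧
    (κ : ℚ) / (2 * κ + 1) ≤ (τ : ℚ) / (p + q) ∧
    (τ : ℚ) / (p + q) < ((κ : ℚ) + 1) / (2 * (κ + 1) + 1)

/-- `phat / qhat` is the core predecessor of `p / q` (whose invariant is `κ`):
`phat = p - 2 κ p'` and `qhat = q - 2 κ q'`, where `p' / q'` is the even predecessor. -/
def IsCorePredecessor (phat qhat p q κ : ℤ) : Prop :=
  IsKappa p q κ ∧ ∃ p' q' : ℤ, IsEvenPredecessor p' q' p q ∧
    phat = p - 2 * κ * p' ∧ qhat = q - 2 * κ * q'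

noncomputable section

/-! ## The grid description of the plaid model -/

/-- `ω = p + q`. -/
def omega (p q : ℤ) : ℝ := (p : ℝ) + q

/-- `P = 2 p / ω`. -/
def slopeP (p q : ℤ) : ℝ := 2 * p / omega p q

/-- `Q = 2 q / ω`. -/
def slopeQ (p q : ℤ) : ℝ := 2 * q / omega p q

/-- The representative of `x` mod `2ℤ` in `[-1, 1)`. -/
def mod2 (x : ℝ) : ℝ := x - 2 * ⌊(x + 1) / 2⌋

/-- The capacity function of the horizontal lines. -/
def FH (p q : ℤ) (z : ℝ × ℝ) : ℝ := mod2 (2 * slopeP p q * z.2)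

/-- The capacity function of the vertical lines. -/
def FV (p q : ℤ) (z : ℝ × ℝ) : ℝ := mod2 (2 * slopeP p q * z.1)

/-- The mass function of the lines of slope `-P`. -/
def FP (p q : ℤ) (z : ℝ × ℝ) : ℝ :=
  mod2 (slopeP p q * z.2 + slopeP p q ^ 2 * z.1 + 1)

/-- The mass function of the lines of slope `-Q`. -/
def FQ (p q : ℤ) (z : ℝ × ℝ) : ℝ :=
  mod2 (slopeP p q * z.2 + slopeP p q * slopeQ p q * z.1 + 1)

/-- `z` lies on a horizontal line with integer `y`-coordinate. -/
def OnH (z : ℝ × ℝ) : Prop := ∃ n : ℤ, z.2 = n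

/-- `z` lies on a vertical line with integer `x`-coordinate. -/
def OnV (z : ℝ × ℝ) : Prop := ∃ n : ℤ, z.1 = n

/-- `z` lies on a line of slope `-P` with integer `y`-intercept. -/
def OnP (p q : ℤ) (z : ℝ × ℝ) : Prop := ∃ k : ℤ, z.2 = -slopeP p q * z.1 + k

/-- `z` lies on a line of slope `-Q` with integer `y`-intercept. -/
def OnQ (p q : ℤ) (z : ℝ × ℝ) : Prop := ∃ k : ℤ, z.2 = -slopeQ p q * z.1 + k

/-- The condition for lightness, `a` being the value of the capacity function and `b` the value
of the mass function at an intersection point. -/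
def LightValues (a b : ℝ) : Prop := |b| < |a| ∧ 0 < a * b

/-- `z` is a light intersection point (of type P or Q) on a horizontal line. -/
def LightH (p q : ℤ) (z : ℝ × ℝ) : Prop :=
  OnH z ∧ ((OnP p q z ∧ LightValues (FH p q z) (FP p q z)) ∨
    (OnQ p q z ∧ LightValues (FH p q z) (FQ p q z)))

/-- `z` is a light intersection point (of type P or Q) on a vertical line. -/
def LightV (p q : ℤ) (z : ℝ × ℝ) : Prop :=
  OnV z ∧ ((OnP p q z ∧ LightValues (FV p q z) (FP p q z)) ∨
    (OnQ p q z ∧ LightValues (FV p q z) (FQ p q z)))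

/-- The horizontal unit segment from `(m, n)` to `(m + 1, n)`. -/
def hSeg (m n : ℤ) : Set (ℝ × ℝ) := Set.Icc (m : ℝ) (m + 1) ×ˢ {(n : ℝ)}

/-- The vertical unit segment from `(m, n)` to `(m, n + 1)`. -/
def vSeg (m n : ℤ) : Set (ℝ × ℝ) := {(m : ℝ)} ×ˢ Set.Icc (n : ℝ) (n + 1)

/-- The center of the horizontal unit segment `hSeg m n`. -/
def hMid (m n : ℤ) : ℝ × ℝ := ((m : ℝ) + 1 / 2, (n : ℝ))

/-- The center of the vertical unit segment `vSeg m n`. -/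
def vMid (m n : ℤ) : ℝ × ℝ := ((m : ℝ), (n : ℝ) + 1 / 2)

open Classical in
/-- The horizontal segment `hSeg m n` is good: it contains exactly one light point, where
a light point which is the midpoint of the segment is counted twice. -/
def GoodH (p q m n : ℤ) : Prop :=
  {z | z ∈ hSeg m n ∧ LightH p q z}.encard + (if LightH p q (hMid m n) then 1 else 0) = 1

/-- The vertical segment `vSeg m n` is good: it contains exactly one light point. -/
def GoodV (p q m n : ℤ) : Prop :=
  {z | z ∈ vSeg m n ∧ LightV p q z}.encard = 1

/-- The center of the unit square `[m, m + 1] × [n, n + 1]`. -/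
def squareCenter (m n : ℤ) : ℝ × ℝ := ((m : ℝ) + 1 / 2, (n : ℝ) + 1 / 2)

/-- What is drawn in the unit square `[m, m + 1] × [n, n + 1]`: the center of the square is
connected to the centers of its good edges (south, north, west, east). -/
def tile (p q m n : ℤ) : Set (ℝ × ℝ) :=
  {z | (GoodH p q m n ∧ z ∈ segment ℝ (squareCenter m n) (hMid m n)) ∨
    (GoodH p q m (n + 1) ∧ z ∈ segment ℝ (squareCenter m n) (hMid m (n + 1))) ∨
    (GoodV p q m n ∧ z ∈ segment ℝ (squareCenter m n) (vMid m n)) ∨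
    (GoodV p q (m + 1) n ∧ z ∈ segment ℝ (squareCenter m n) (vMid (m + 1) n))}

/-- The plaid tiling: the union of all plaid polygons. -/
def plaidTiling (p q : ℤ) : Set (ℝ × ℝ) := ⋃ (m : ℤ) (n : ℤ), tile p q m n

/-! ## The box `R_{p/q}` -/

/-- The capacity of the vertical line `x = m`. -/
def capacityV (p q m : ℤ) : ℝ := |omega p q * FV p q ((m : ℝ), 0)|

/-- The `x`-coordinate of the vertical line of (positive) capacity at most `4` which is closest
to the left edge `x = 0` of the first block. -/
def boxWidth (p q : ℤ) : ℕ :=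
  sInf {m : ℕ | 0 < m ∧ 0 < capacityV p q m ∧ capacityV p q m ≤ 4}

/-- The rectangle bounded by the bottom, left and top of the first block `[0, ω]²` and by the
line `x = boxWidth p q`. -/
def box (p q : ℤ) : Set (ℝ × ℝ) := Set.Icc 0 (boxWidth p q : ℝ) ×ˢ Set.Icc 0 (omega p q)

/-- Vertical translation by `t`. -/
def vTranslate (t : ℝ) (z : ℝ × ℝ) : ℝ × ℝ := (z.1, z.2 + t)

end

end Plaid

namespace Plaid

/-! ## Arithmetic of even parameters -/

/-! Write ω' = p' + q' and let ω̂ belong to the core predecessor. Then ω = ω̂ + 2κω', so the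
translation is by the integer κω', and it suffices to match good edges.

Goodness is a parity. A slanting line enters lightness only through its intercept k, and it is light
on the line of index c exactly when N(k) - N(k - 2c) - N(2c) is odd, where N is `nearest`
(`lightValues_iff_odd`). Each relevant edge has exactly two candidate light points, with intercepts
determined by the edge and by ⌊Pm⌋. It is good when exactly one is light, and then N(2c) drops out
(`not_lightIndex_iff`).

The rest is Diophantine approximation. The definition of κ amounts to ω' < ω̂ < 3ω'
(`IsCorePredecessor.exists_isCore`). The Farey relation then shows that, on a long interval, N for
p/q shifted by κω' is N for the core plus κp' (`IsCore.nearest_add`), and that the floors agree for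
0 ≤ m < ω̂/2 (`IsCore.floor_eq`). The line x = (ω̂ - ω')/2 has capacity 2, which makes the box
narrow enough to keep all intercepts in that interval (`IsCore.two_mul_boxWidth_le`). -/

lemma IsEvenParameter.odd_add {p q : ℤ} (h : IsEvenParameter p q) : Odd (p + q) := by
  obtain ⟨a, b, hab⟩ := h.coprime
  by_contra hodd
  have hs := Int.not_odd_iff_even.1 hodd
  have hm := h.even
  have h1 : Even p ∧ Even q := by
    rw [Int.even_add] at hs
    rw [Int.even_mul] at hm
    tauto
  have h2 : Even (a * p + b * q) := (h1.1.mul_left a).add (h1.2.mul_left b)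
  rw [hab] at h2
  exact Int.not_even_one h2

lemma IsEvenParameter.isCoprime_left {p q : ℤ} (h : IsEvenParameter p q) :
    IsCoprime p (p + q) := by
  have := h.coprime.add_mul_left_right 1
  simpa [add_comm] using this

lemma IsEvenParameter.isCoprime_right {p q : ℤ} (h : IsEvenParameter p q) :
    IsCoprime q (p + q) := by
  have := h.coprime.symm.add_mul_left_right 1
  simpa [add_comm] using this

lemma IsEvenParameter.three_le {p q : ℤ} (h : IsEvenParameter p q) : 3 ≤ p + q := by
  have := h.pos
  have := h.lt
  omega

lemma IsEvenParameter.omega_pos {p q : ℤ} (h : IsEvenParameter p q) : 0 < omega p q := by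
  have := h.three_le
  have h1 : (0 : ℝ) < ((p + q : ℤ) : ℝ) := by exact_mod_cast (by omega : 0 < p + q)
  simpa [omega] using h1

lemma omega_eq_cast (p q : ℤ) : omega p q = ((p + q : ℤ) : ℝ) := by simp [omega]

/-- The integer nearest to `p k / (p + q)`. -/
def nearest (p q k : ℤ) : ℤ := (2 * p * k + (p + q)) / (2 * (p + q))

lemma ediv_eq_of_bounds {a b c : ℤ} (hb : 0 < b) (h1 : b * c ≤ a) (h2 : a < b * c + b) :
    a / b = c :=
  Int.ediv_eq_iff_of_pos hb |>.2 ⟨by linarith, by linarith⟩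

lemma ediv_bounds (a : ℤ) {b : ℤ} (hb : 0 < b) : b * (a / b) ≤ a ∧ a < b * (a / b) + b :=
  ⟨Int.mul_ediv_self_le hb.ne', Int.lt_mul_ediv_self_add hb⟩

/-! ### Lightness as a parity of nearest integers -/

lemma mod2_div (x : ℤ) {w : ℤ} (hw : 0 < w) :
    mod2 ((x : ℝ) / w) = ((x - 2 * w * ((x + w) / (2 * w)) : ℤ) : ℝ) / w := by
  have hw' : (0 : ℝ) < w := by exact_mod_cast hw
  obtain ⟨h1, h2⟩ := ediv_bounds (x + w) (b := 2 * w) (by omega)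
  have hf : ⌊((x : ℝ) / w + 1) / 2⌋ = (x + w) / (2 * w) := by
    rw [Int.floor_eq_iff]
    generalize (x + w) / (2 * w) = u at *
    have h1' : (2 * w * u : ℝ) ≤ x + w := by exact_mod_cast h1
    have h2' : (x + w : ℝ) < 2 * w * u + 2 * w := by exact_mod_cast h2
    have e : ((x : ℝ) / w + 1) / 2 = (x + w) / (2 * w) := by field_simp
    rw [e, le_div_iff₀ (by positivity), div_lt_iff₀ (by positivity)]
    constructor <;> linarith
  rw [mod2, hf]
  push_cast
  field_simp

lemma lightValues_div {a b : ℤ} {w : ℤ} (hw : 0 < w) :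
    LightValues ((a : ℝ) / w) ((b : ℝ) / w) ↔ |b| < |a| ∧ 0 < a * b := by
  have hw' : (0 : ℝ) < w := by exact_mod_cast hw
  unfold LightValues
  rw [abs_div, abs_div, abs_of_pos hw', div_lt_div_iff_of_pos_right hw', div_mul_div_comm,
    div_pos_iff_of_pos_right (by positivity)]
  exact and_congr (by exact_mod_cast Iff.rfl) (by exact_mod_cast Iff.rfl)

/-- Lightness of a residue `A` with respect to a residue `C` modulo `2 w`, as a parity. -/
lemma light_residue_iff_odd {A C w : ℤ} (hw : 0 < w) (hA : Odd A) (hC : Even C) :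
    (|A - 2 * w * ((A + w) / (2 * w))| < |C - 2 * w * ((C + w) / (2 * w))| ∧
      0 < (C - 2 * w * ((C + w) / (2 * w))) * (A - 2 * w * ((A + w) / (2 * w)))) ↔
    Odd (A / (2 * w) - (A - C) / (2 * w) - (C + w) / (2 * w)) := by
  obtain ⟨a1, a2⟩ := ediv_bounds (A + w) (b := 2 * w) (by omega)
  obtain ⟨c1, c2⟩ := ediv_bounds (C + w) (b := 2 * w) (by omega)
  generalize (A + w) / (2 * w) = u at *
  generalize (C + w) / (2 * w) = v at *
  obtain ⟨b, hb⟩ : ∃ b, b = A - 2 * w * u := ⟨_, rfl⟩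
  obtain ⟨a, ha⟩ : ∃ a, a = C - 2 * w * v := ⟨_, rfl⟩
  rw [← ha, ← hb]
  have hbo : Odd b := by
    rw [hb, mul_assoc]; exact hA.sub_even (even_two_mul _)
  have hae : Even a := by
    rw [ha, mul_assoc]; exact hC.sub (even_two_mul _)
  have hb1 : -w ≤ b := by linarith
  have hb2 : b < w := by linarith
  have ha1 : -w ≤ a := by linarith
  have ha2 : a < w := by linarith
  have hb0 : b ≠ 0 := by rintro rfl; simp at hbo
  have hab : b ≠ a := by rintro rfl; exact Int.not_even_iff_odd.2 hbo hae
  -- Lightness says that b lies strictly between 0 and a, that is, exactly one of b < 0 and b < a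
  -- holds. The floors record these two conditions. Since b is odd and a even, b equals neither 0
  -- nor a.
  have e1 : A / (2 * w) = u + if b < 0 then -1 else 0 := by
    split_ifs <;> apply ediv_eq_of_bounds (by omega) <;> linarith
  have e2 : (A - C) / (2 * w) = u - v + if b < a then -1 else 0 := by
    split_ifs <;> apply ediv_eq_of_bounds (by omega) <;> linarith
  rw [e1, e2]
  have key : (|b| < |a| ∧ 0 < a * b) ↔ ((0 < b ∧ b < a) ∨ (b < 0 ∧ a < b)) := by
    rw [mul_pos_iff]
    constructor
    · rintro ⟨h, h' | h'⟩
      · left; rw [abs_of_pos h'.1, abs_of_pos h'.2] at h; exact ⟨h'.2, h⟩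
      · right; rw [abs_of_neg h'.1, abs_of_neg h'.2] at h; exact ⟨h'.2, by omega⟩
    · rintro (h | h)
      · rw [abs_of_pos h.1, abs_of_pos (h.1.trans h.2)]; omega
      · rw [abs_of_neg h.1, abs_of_neg (h.2.trans h.1)]; omega
  rw [key, Int.odd_iff]
  split_ifs <;> omega

lemma lightValues_iff_odd {p q : ℤ} (h : IsEvenParameter p q) (c k : ℤ) :
    LightValues (mod2 (2 * slopeP p q * c)) (mod2 (slopeP p q * k + 1)) ↔
      Odd (nearest p q k - nearest p q (k - 2 * c) - nearest p q (2 * c)) := by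
  have hw : 0 < p + q := by have := h.three_le; omega
  have hw' : ((p + q : ℤ) : ℝ) ≠ 0 := by exact_mod_cast hw.ne'
  have e1 : 2 * slopeP p q * c = ((4 * p * c : ℤ) : ℝ) / ((p + q : ℤ) : ℝ) := by
    rw [slopeP, omega_eq_cast]; push_cast; ring
  have e2 : slopeP p q * k + 1 = ((2 * p * k + (p + q) : ℤ) : ℝ) / ((p + q : ℤ) : ℝ) := by
    rw [slopeP, omega_eq_cast]
    rw [show ((2 * p * k + (p + q) : ℤ) : ℝ) = 2 * p * k + ((p + q : ℤ) : ℝ) by push_cast; ring]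
    field_simp
  rw [e1, e2, mod2_div _ hw, mod2_div _ hw, lightValues_div hw, light_residue_iff_odd hw]
  · unfold nearest
    rw [show 2 * p * k + (p + q) - 4 * p * c = 2 * p * (k - 2 * c) + (p + q) by ring,
      show 2 * p * (2 * c) = 4 * p * c by ring]
  · rw [mul_assoc]; exact (even_two_mul _).add_odd h.odd_add
  · exact ⟨2 * p * c, by ring⟩

/-- There are no ties because ω is odd, so the half-open condition of the floor becomes symmetric.
This is what makes `nearest` an odd function. -/
lemma nearest_eq_iff {p q : ℤ} (h : IsEvenParameter p q) {k r : ℤ} :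
    nearest p q k = r ↔ |2 * (p * k - r * (p + q))| < p + q := by
  have hw := h.three_le
  obtain ⟨t, ht⟩ := h.odd_add
  rw [nearest, Int.ediv_eq_iff_of_pos (by omega), abs_lt]
  constructor
  · rintro ⟨h1, h2⟩
    have h1' : -(p + q) ≤ 2 * (p * k - r * (p + q)) := by linarith
    have h2' : 2 * (p * k - r * (p + q)) < p + q := by linarith
    omega
  · rintro ⟨h1, h2⟩
    constructor <;> linarith

lemma nearest_neg {p q : ℤ} (h : IsEvenParameter p q) (k : ℤ) :
    nearest p q (-k) = -nearest p q k := by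
  rw [nearest_eq_iff h]
  have := (nearest_eq_iff h).1 (rfl : nearest p q k = _)
  rw [← abs_neg]
  convert this using 2
  ring

/-! ## Core predecessors -/

/-- `p / q` is obtained from `a / b` by adding `2 κ` copies of `p' / q'`, which is Farey related
to `a / b` and satisfies `ω' < a + b < 3 ω'`. -/
structure IsCore (a b p' q' κ p q : ℤ) : Prop where
  param : IsEvenParameter p q
  core : IsEvenParameter a b
  kappa_nonneg : 0 ≤ κ
  p_eq : p = a + 2 * κ * p'
  q_eq : q = b + 2 * κ * q'
  farey : |a * (p' + q') - p' * (a + b)| = 1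
  lt : p' + q' < a + b
  lt_three : a + b < 3 * (p' + q')
  odd : Odd (p' + q')

/-- The Farey relation gives pω' ≡ ±1 mod ω, as does the tune for 2pτ; cancelling p leaves 2τ ≡ ±ω'
mod ω. Size, and oddness of ω' in the case 2τ = ω', leave one possibility. -/
lemma IsTune.two_mul_eq {p q p' q' τ : ℤ} (hτ : IsTune p q τ)
    (hpred : IsEvenPredecessor p' q' p q) : 2 * τ = (p + q) - (p' + q') := by
  obtain ⟨h', h, hF, hlt⟩ := hpred
  obtain ⟨h0, h1, h2⟩ := hτ
  have hw' := h'.three_le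
  obtain ⟨t, ht⟩ := h'.odd_add
  have hF' : p * (p' + q') - p' * (p + q) = 1 ∨ p * (p' + q') - p' * (p + q) = -1 := by
    rcases (abs_eq (zero_le_one)).1 hF with e | e
    · right; linarith
    · left; linarith
  have hdvd : (p + q) ∣ 2 * τ + (p' + q') ∨ (p + q) ∣ 2 * τ - (p' + q') := by
    have hc := h.isCoprime_left.symm
    rcases h2 with h2 | h2 <;> obtain ⟨c, hc2⟩ := h2.dvd <;> rcases hF' with e | e
    · right; exact hc.dvd_of_dvd_mul_left ⟨-c - p', by linear_combination -hc2 - e⟩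
    · left; exact hc.dvd_of_dvd_mul_left ⟨-c + p', by linear_combination -hc2 + e⟩
    · left; exact hc.dvd_of_dvd_mul_left ⟨-c + p', by linear_combination -hc2 + e⟩
    · right; exact hc.dvd_of_dvd_mul_left ⟨-c - p', by linear_combination -hc2 - e⟩
  rcases hdvd with hd | hd
  · by_cases hs : p + q ≤ 2 * τ + (p' + q')
    · have := Int.eq_zero_of_dvd_of_nonneg_of_lt (m := 2 * τ + (p' + q') - (p + q)) (n := p + q)
        (by omega) (by omega) (dvd_sub_self_right.2 hd)
      omega
    · have := Int.eq_zero_of_dvd_of_nonneg_of_lt (by omega) (by omega) hd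
      omega
  · have := Int.eq_zero_of_abs_lt_dvd hd (by rw [abs_lt]; omega)
    omega

/-- Substituting 2τ = ω - ω' turns the two inequalities defining κ into ω' ≤ ω̂ < 3ω'. Equality on
the left would make ω' ≥ 3 divide the Farey determinant ±1. -/
lemma IsCorePredecessor.exists_isCore {a b p q κ : ℤ} (hcore : IsCorePredecessor a b p q κ) :
    ∃ p' q', IsCore a b p' q' κ p q := by
  obtain ⟨⟨hκ, τ, hτ, hle, hlt⟩, p', q', hpred, ha, hb⟩ := hcore
  have h2 := hτ.two_mul_eq hpred
  obtain ⟨h', h, hF, hw⟩ := hpred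
  have hw' := h'.three_le
  have hκQ : (0 : ℚ) ≤ κ := by exact_mod_cast hκ
  have hwQ : (0 : ℚ) < p + q := by exact_mod_cast (by omega : 0 < p + q)
  rw [div_le_div_iff₀ (by positivity) hwQ] at hle
  rw [div_lt_div_iff₀ hwQ (by positivity)] at hlt
  have hle' : κ * (p + q) ≤ τ * (2 * κ + 1) := by exact_mod_cast hle
  have hlt' : τ * (2 * (κ + 1) + 1) < (κ + 1) * (p + q) := by exact_mod_cast hlt
  have ew : a + b = p + q - 2 * κ * (p' + q') := by rw [ha, hb]; ring
  have hF' : |a * (p' + q') - p' * (a + b)| = 1 := by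
    rw [← hF, ← abs_neg]; congr 1; rw [ha, hb]; ring
  have hle2 : p' + q' ≤ a + b := by
    have : 2 * (τ * (2 * κ + 1)) = ((p + q) - (p' + q')) * (2 * κ + 1) := by rw [← h2]; ring
    rw [ew]; linarith
  have hlt2 : a + b < 3 * (p' + q') := by
    have : 2 * (τ * (2 * (κ + 1) + 1)) = ((p + q) - (p' + q')) * (2 * (κ + 1) + 1) := by
      rw [← h2]; ring
    rw [ew]; linarith
  have hne : p' + q' ≠ a + b := by
    intro e
    rw [← e, ← sub_mul, abs_mul] at hF'
    have := Int.eq_one_of_mul_eq_one_left (abs_nonneg (p' + q')) hF'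
    rw [abs_of_pos (by omega)] at this
    omega
  have hlt3 : p' + q' < a + b := lt_of_le_of_ne hle2 hne
  have hs := (abs_le.1 hF'.le)
  refine ⟨p', q', h, ?_, hκ, by rw [ha]; ring, by rw [hb]; ring, hF', hlt3, hlt2, h'.odd_add⟩
  have hp' := h'.pos
  have hq' := h'.lt
  have hapos : 0 < a := by
    have : 0 < a * (p' + q') := by nlinarith
    exact pos_of_mul_pos_left this (by omega)
  have hab : a < b := by
    have : 0 < (b - a) * (p' + q') := by nlinarith
    have := pos_of_mul_pos_left this (by omega)
    omega
  refine ⟨hapos, hab, ?_, ?_⟩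
  · rcases (abs_eq zero_le_one).1 hF' with e | e
    · exact ⟨q', -p', by linear_combination e⟩
    · exact ⟨-q', p', by linear_combination -e⟩
  · have hm := h.even
    rw [Int.even_mul] at hm ⊢
    have e1 : Even p ↔ Even a := by
      rw [show p = a + 2 * (κ * p') by rw [ha]; ring, Int.even_add]; simp
    have e2 : Even q ↔ Even b := by
      rw [show q = b + 2 * (κ * q') by rw [hb]; ring, Int.even_add]; simp
    rwa [e1, e2] at hm

section Core

variable {a b p' q' κ p q : ℤ}

lemma IsCore.add_eq (h : IsCore a b p' q' κ p q) : p + q = a + b + 2 * κ * (p' + q') := by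
  rw [h.p_eq, h.q_eq]; ring

/-- On a long interval, the integers nearest to the multiples of `p / ω` and of `phat / omegahat`
agree up to a translation. -/
lemma IsCore.nearest_add (h : IsCore a b p' q' κ p q) {k : ℤ}
    (hk : |2 * k - (a + b)| < 2 * (a + b) + (p' + q')) :
    nearest p q (k + κ * (p' + q')) = κ * p' + nearest a b k := by
  rw [nearest_eq_iff h.param]
  have he := (nearest_eq_iff h.core).1 (rfl : nearest a b k = _)
  generalize nearest a b k = r at *
  have hw := h.core.three_le
  have hlt := h.lt
  have hlt3 := h.lt_three
  have hκ := h.kappa_nonneg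
  obtain ⟨t, ht⟩ := h.core.odd_add
  obtain ⟨t', ht'⟩ := h.odd
  obtain ⟨e, hee⟩ : ∃ e, e = a * k - r * (a + b) := ⟨_, rfl⟩
  obtain ⟨s, hs⟩ : ∃ s, s = a * (p' + q') - p' * (a + b) := ⟨_, rfl⟩
  -- The error for p/q will be e + κd, so |d| ≤ ω' suffices. The range of k only gives |d| < ω' + 2,
  -- but d and ω' are both odd, which closes the gap.
  obtain ⟨d, hd⟩ : ∃ d, d = 2 * (p' * k - r * (p' + q')) + s := ⟨_, rfl⟩
  have hF : s = 1 ∨ s = -1 := by rw [hs]; exact (abs_eq zero_le_one).1 h.farey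
  rw [← hee, abs_lt] at he
  have he1 : 2 * e ≤ (a + b) - 1 := by omega
  have he2 : -((a + b) - 1) ≤ 2 * e := by omega
  have hdodd : d % 2 = 1 := by omega
  have hds : (a + b) * d = (p' + q') * (2 * e) - s * (2 * k - (a + b)) := by
    rw [hd, hee, hs]; ring
  have hsk : |s * (2 * k - (a + b))| < 2 * (a + b) + (p' + q') := by
    rcases hF with e | e <;> rw [e]
    · simpa using hk
    · rw [neg_one_mul, abs_neg]; exact hk
  rw [abs_lt] at hsk
  have m1 : (p' + q') * (2 * e) ≤ (p' + q') * ((a + b) - 1) :=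
    mul_le_mul_of_nonneg_left he1 (by omega)
  have m2 : (p' + q') * (-((a + b) - 1)) ≤ (p' + q') * (2 * e) :=
    mul_le_mul_of_nonneg_left he2 (by omega)
  have d1 : d < p' + q' + 2 := by
    have : (a + b) * d < (a + b) * (p' + q' + 2) := by linarith
    exact lt_of_mul_lt_mul_left this (by omega)
  have d2 : -(p' + q' + 2) < d := by
    have : (a + b) * (-(p' + q' + 2)) < (a + b) * d := by linarith
    exact lt_of_mul_lt_mul_left this (by omega)
  have k1 : κ * d ≤ κ * (p' + q') := mul_le_mul_of_nonneg_left (by omega) hκ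
  have k2 : κ * (-(p' + q')) ≤ κ * d := mul_le_mul_of_nonneg_left (by omega) hκ
  have hgoal : p * (k + κ * (p' + q')) - (κ * p' + r) * (p + q) = e + κ * d := by
    rw [hd, hee, hs, h.p_eq, h.q_eq]; ring
  rw [hgoal, h.add_eq, abs_lt]
  constructor <;> linarith

/-- If e is the remainder for the core, then e + 2κd is the one for p/q, and the Farey relation with
2m < ω̂ forces 0 ≤ d ≤ ω'. -/
lemma IsCore.floor_eq (h : IsCore a b p' q' κ p q) {m : ℤ} (hm : 0 ≤ m) (hm' : 2 * m < a + b) :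
    2 * p * m / (p + q) = 2 * a * m / (a + b) := by
  have hw := h.core.three_le
  have hwp := h.param.three_le
  have hlt := h.lt
  have hlt3 := h.lt_three
  have hκ := h.kappa_nonneg
  obtain ⟨h1, h2⟩ := ediv_bounds (2 * a * m) (b := a + b) (by omega)
  generalize 2 * a * m / (a + b) = r at *
  obtain ⟨e, hee⟩ : ∃ e, e = 2 * a * m - r * (a + b) := ⟨_, rfl⟩
  obtain ⟨s, hs⟩ : ∃ s, s = a * (p' + q') - p' * (a + b) := ⟨_, rfl⟩
  obtain ⟨d, hd⟩ : ∃ d, d = 2 * p' * m - r * (p' + q') := ⟨_, rfl⟩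
  have hF : s = 1 ∨ s = -1 := by rw [hs]; exact (abs_eq zero_le_one).1 h.farey
  have he1 : 0 ≤ e := by linarith
  have he2 : e ≤ a + b := by linarith
  have hds : (a + b) * d = (p' + q') * e - s * (2 * m) := by rw [hd, hee, hs]; ring
  have hsm : -(a + b) < s * (2 * m) ∧ s * (2 * m) < a + b := by
    rcases hF with e | e <;> rw [e] <;> omega
  have m1 : 0 ≤ (p' + q') * e := mul_nonneg (by omega) he1
  have m2 : (p' + q') * e ≤ (p' + q') * (a + b) := mul_le_mul_of_nonneg_left he2 (by omega)
  have d1 : -1 < d := by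
    have : (a + b) * (-1) < (a + b) * d := by linarith
    exact lt_of_mul_lt_mul_left this (by omega)
  have d2 : d < p' + q' + 1 := by
    have : (a + b) * d < (a + b) * (p' + q' + 1) := by linarith
    exact lt_of_mul_lt_mul_left this (by omega)
  have k1 : 0 ≤ κ * d := mul_nonneg hκ (by omega)
  have k2 : κ * d ≤ κ * (p' + q') := mul_le_mul_of_nonneg_left (by omega) hκ
  have hgoal : 2 * p * m = (p + q) * r + e + 2 * (κ * d) := by
    rw [hd, hee, h.p_eq, h.q_eq]; ring
  have hadd := h.add_eq
  apply ediv_eq_of_bounds (by omega) <;> linarith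

/-- The witness is m = (ω̂ - ω')/2: by the Farey relation 4am ≡ -2aω' ≡ ±2 mod 2ω̂, so its capacity
is 2. -/
lemma IsCore.two_mul_boxWidth_le (h : IsCore a b p' q' κ p q) :
    2 * (boxWidth a b : ℤ) ≤ (a + b) - (p' + q') := by
  have hw := h.core.three_le
  have hlt := h.lt
  obtain ⟨t, ht⟩ := h.core.odd_add
  obtain ⟨t', ht'⟩ := h.odd
  have hF := (abs_eq zero_le_one).1 h.farey
  have hw0 : (((a + b : ℤ)) : ℝ) ≠ 0 := by exact_mod_cast (by omega : a + b ≠ 0)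
  have hcap : capacityV a b (t - t') = 2 := by
    have e1 : 2 * slopeP a b * ((t - t' : ℤ) : ℝ) =
        ((4 * a * (t - t') : ℤ) : ℝ) / ((a + b : ℤ) : ℝ) := by
      rw [slopeP, omega_eq_cast]; push_cast; ring
    have e2 : 4 * a * (t - t') =
        2 * (a + b) * (a - p') - 2 * (a * (p' + q') - p' * (a + b)) := by
      rw [show 4 * a * (t - t') = 2 * a * ((a + b) - (p' + q')) by rw [ht, ht']; ring]; ring
    have e3 : (4 * a * (t - t') + (a + b)) / (2 * (a + b)) = a - p' := by
      rcases hF with e | e <;> rw [e2, e] <;> apply ediv_eq_of_bounds (by omega) <;> linarith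
    have e4 : 4 * a * (t - t') - 2 * (a + b) * (a - p') =
        -2 * (a * (p' + q') - p' * (a + b)) := by rw [e2]; ring
    simp only [capacityV, FV]
    rw [e1, mod2_div _ (by omega), e3, e4, omega_eq_cast, mul_div_cancel₀ _ hw0, ← Int.cast_abs,
      abs_mul, h.farey]
    norm_num
  have hmem : (t - t').toNat ∈ {m : ℕ | 0 < m ∧ 0 < capacityV a b m ∧ capacityV a b m ≤ 4} := by
    have hc : (((t - t').toNat : ℕ) : ℤ) = t - t' := Int.toNat_of_nonneg (by omega)
    refine ⟨by omega, ?_, ?_⟩ <;> rw [hc, hcap] <;> norm_num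
  have : boxWidth a b ≤ (t - t').toNat := Nat.sInf_le hmem
  omega

end Core

/-! ## Intersection points on the unit segments -/

lemma encard_two_points_eq_one_iff {α : Type*} {S : Set α} {x y : α} {A B : Prop} (hxy : x ≠ y)
    (hS : ∀ z, z ∈ S ↔ (z = x ∧ A) ∨ (z = y ∧ B)) : S.encard = 1 ↔ ¬(A ↔ B) := by
  by_cases hA : A <;> by_cases hB : B
  · have : S = {x, y} := by ext z; simp [hS, hA, hB]
    rw [this, Set.encard_pair hxy]
    simp [hA, hB]
  · have : S = {x} := by ext z; simp [hS, hA, hB]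
    simp [this, hA, hB]
  · have : S = {y} := by ext z; simp [hS, hA, hB]
    simp [this, hA, hB]
  · have : S = ∅ := by ext z; simp [hS, hA, hB]
    simp [this, hA, hB]

/-! ### Slopes of the slanting lines and the floor of P m -/

section Slopes

variable {p q : ℤ} (h : IsEvenParameter p q)
include h

lemma IsEvenParameter.slopeQ_eq : slopeQ p q = 2 - slopeP p q := by
  have := h.omega_pos
  rw [slopeP, slopeQ]
  field_simp
  rw [omega]
  ring

lemma IsEvenParameter.slopeP_pos : 0 < slopeP p q := by
  have h1 : (0 : ℝ) < p := by exact_mod_cast h.pos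
  have h2 := h.omega_pos
  rw [slopeP]
  positivity

lemma IsEvenParameter.slopeP_lt_one : slopeP p q < 1 := by
  have h1 : (p : ℝ) < q := by exact_mod_cast h.lt
  rw [slopeP, div_lt_one h.omega_pos, omega]
  linarith

lemma IsEvenParameter.slopeQ_pos : 0 < slopeQ p q := by
  rw [h.slopeQ_eq]
  linarith [h.slopeP_lt_one]

lemma IsEvenParameter.le_slopeP_mul_iff {c m : ℤ} :
    (c : ℝ) ≤ slopeP p q * m ↔ (p + q) * c ≤ 2 * p * m := by
  rw [slopeP, div_mul_eq_mul_div, le_div_iff₀ h.omega_pos, omega_eq_cast, mul_comm (p + q)]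
  exact_mod_cast Iff.rfl

lemma IsEvenParameter.slopeP_mul_le_iff {c m : ℤ} :
    slopeP p q * m ≤ (c : ℝ) ↔ 2 * p * m ≤ (p + q) * c := by
  rw [slopeP, div_mul_eq_mul_div, div_le_iff₀ h.omega_pos, omega_eq_cast, mul_comm (p + q)]
  exact_mod_cast Iff.rfl

lemma IsEvenParameter.floor_le (m : ℤ) : ((2 * p * m / (p + q) : ℤ) : ℝ) ≤ slopeP p q * m := by
  have := h.three_le
  rw [h.le_slopeP_mul_iff]
  exact (ediv_bounds _ (by omega)).1

lemma IsEvenParameter.lt_floor_add_one (m : ℤ) :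
    slopeP p q * m < ((2 * p * m / (p + q) : ℤ) : ℝ) + 1 := by
  have := h.three_le
  have e : ((2 * p * m / (p + q) : ℤ) : ℝ) + 1 = ((2 * p * m / (p + q) + 1 : ℤ) : ℝ) := by simp
  rw [e, ← not_le, h.le_slopeP_mul_iff, not_le, mul_add, mul_one]
  exact (ediv_bounds _ (by omega)).2

lemma IsEvenParameter.not_dvd_mul {m : ℤ} (hm : 0 < m) (hm' : m < p + q) :
    ¬ (p + q) ∣ p * m := by
  intro hd
  have := Int.le_of_dvd hm (h.isCoprime_left.symm.dvd_of_dvd_mul_left hd)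
  omega

lemma IsEvenParameter.isCoprime_two : IsCoprime (p + q) 2 := by
  obtain ⟨t, ht⟩ := h.odd_add
  exact ⟨1, -t, by rw [ht]; ring⟩

lemma IsEvenParameter.floor_lt {m : ℤ} (hm : 0 < m) (hm' : m < p + q) :
    ((2 * p * m / (p + q) : ℤ) : ℝ) < slopeP p q * m := by
  have hw := h.three_le
  rw [← not_le, h.slopeP_mul_le_iff, not_le]
  refine lt_of_le_of_ne (ediv_bounds _ (by omega)).1 fun e ↦ h.not_dvd_mul hm hm' ?_
  refine h.isCoprime_two.dvd_of_dvd_mul_left ?_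
  rw [← mul_assoc, ← e]
  exact dvd_mul_right _ _

lemma IsEvenParameter.floor_nonneg {m : ℤ} (hm : 0 ≤ m) : 0 ≤ 2 * p * m / (p + q) := by
  have := h.pos
  have := h.three_le
  exact Int.ediv_nonneg (by positivity) (by omega)

lemma IsEvenParameter.floor_le_self {m : ℤ} (hm : 0 ≤ m) : 2 * p * m / (p + q) ≤ m := by
  have := h.lt
  have := h.three_le
  exact Int.ediv_le_of_le_mul (by omega) (by nlinarith)

lemma IsEvenParameter.floor_succ (m : ℤ) :
    2 * p * (m + 1) / (p + q) = 2 * p * m / (p + q) ∨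
      2 * p * (m + 1) / (p + q) = 2 * p * m / (p + q) + 1 := by
  have h1 := h.floor_le m
  have h2 := h.lt_floor_add_one m
  have h3 := h.floor_le (m + 1)
  have h4 := h.lt_floor_add_one (m + 1)
  have h5 := h.slopeP_pos
  have h6 := h.slopeP_lt_one
  generalize 2 * p * m / (p + q) = f at *
  generalize 2 * p * (m + 1) / (p + q) = g at *
  push_cast at h3 h4
  have i1 : (g : ℝ) < ((f + 2 : ℤ) : ℝ) := by push_cast; linarith
  have i2 : (f : ℝ) < ((g + 1 : ℤ) : ℝ) := by push_cast; linarith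
  have j1 : g < f + 2 := by exact_mod_cast i1
  have j2 : f < g + 1 := by exact_mod_cast i2
  omega

end Slopes

/-! ### Light points in terms of intercepts -/

lemma FP_eq_of_mem_line {p q : ℤ} {z : ℝ × ℝ} {k : ℤ} (hz : z.2 = -slopeP p q * z.1 + k) :
    FP p q z = mod2 (slopeP p q * k + 1) := by
  rw [FP, hz]; ring_nf

/-- The mass is constant along a slanting line and the same for both slopes, so one predicate
`LightIndex` serves both families. -/
lemma FQ_eq_of_mem_line {p q : ℤ} {z : ℝ × ℝ} {k : ℤ} (hz : z.2 = -slopeQ p q * z.1 + k) :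
    FQ p q z = mod2 (slopeP p q * k + 1) := by
  rw [FQ, hz]; ring_nf

/-- The slanting line of intercept `k` is light on the horizontal or vertical line indexed by
`c`. -/
def LightIndex (p q c k : ℤ) : Prop :=
  LightValues (mod2 (2 * slopeP p q * c)) (mod2 (slopeP p q * k + 1))

lemma not_lightIndex_iff {p q : ℤ} (h : IsEvenParameter p q) (c k l : ℤ) :
    ¬(LightIndex p q c k ↔ LightIndex p q c l) ↔
      Odd ((nearest p q k - nearest p q (k - 2 * c)) +
        (nearest p q l - nearest p q (l - 2 * c))) := by
  rw [LightIndex, LightIndex, lightValues_iff_odd h, lightValues_iff_odd h]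
  generalize nearest p q (2 * c) = s
  generalize nearest p q k - nearest p q (k - 2 * c) = x
  generalize nearest p q l - nearest p q (l - 2 * c) = y
  simp only [Int.odd_iff]
  omega

lemma lightH_iff {p q n : ℤ} {z : ℝ × ℝ} (hz : z.2 = n) :
    LightH p q z ↔ ∃ k : ℤ, LightIndex p q n k ∧
      ((n : ℝ) = -slopeP p q * z.1 + k ∨ (n : ℝ) = -slopeQ p q * z.1 + k) := by
  have hF : FH p q z = mod2 (2 * slopeP p q * n) := by rw [FH, hz]
  constructor
  · rintro ⟨-, ⟨⟨k, hk⟩, hl⟩ | ⟨⟨k, hk⟩, hl⟩⟩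
    · rw [hF, FP_eq_of_mem_line hk] at hl
      exact ⟨k, hl, .inl (hz ▸ hk)⟩
    · rw [hF, FQ_eq_of_mem_line hk] at hl
      exact ⟨k, hl, .inr (hz ▸ hk)⟩
  · rintro ⟨k, hl, hk | hk⟩ <;> rw [← hz] at hk
    · exact ⟨⟨n, hz⟩, .inl ⟨⟨k, hk⟩, by rw [hF, FP_eq_of_mem_line hk]; exact hl⟩⟩
    · exact ⟨⟨n, hz⟩, .inr ⟨⟨k, hk⟩, by rw [hF, FQ_eq_of_mem_line hk]; exact hl⟩⟩

lemma lightV_iff {p q m : ℤ} {z : ℝ × ℝ} (hz : z.1 = m) :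
    LightV p q z ↔ ∃ k : ℤ, LightIndex p q m k ∧
      (z.2 = -slopeP p q * m + k ∨ z.2 = -slopeQ p q * m + k) := by
  have hF : FV p q z = mod2 (2 * slopeP p q * m) := by rw [FV, hz]
  constructor
  · rintro ⟨-, ⟨⟨k, hk⟩, hl⟩ | ⟨⟨k, hk⟩, hl⟩⟩
    · rw [hF, FP_eq_of_mem_line hk] at hl
      exact ⟨k, hl, .inl (hz ▸ hk)⟩
    · rw [hF, FQ_eq_of_mem_line hk] at hl
      exact ⟨k, hl, .inr (hz ▸ hk)⟩
  · rintro ⟨k, hl, hk | hk⟩ <;> rw [← hz] at hk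
    · exact ⟨⟨m, hz⟩, .inl ⟨⟨k, hk⟩, by rw [hF, FP_eq_of_mem_line hk]; exact hl⟩⟩
    · exact ⟨⟨m, hz⟩, .inr ⟨⟨k, hk⟩, by rw [hF, FQ_eq_of_mem_line hk]; exact hl⟩⟩

/-! ### Good edges in terms of two candidate intercepts -/

section Good

variable {p q : ℤ} (h : IsEvenParameter p q)
include h

/-- One P-line and one Q-line cross the edge. Since P + Q = 2, the crossings are symmetric about its
midpoint. -/
lemma goodV_iff_of_pos {m : ℤ} (n : ℤ) (hm : 0 < m) (hm' : m < p + q) :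
    GoodV p q m n ↔
      ¬(LightIndex p q m (n + 2 * p * m / (p + q) + 1) ↔
        LightIndex p q m (n + 2 * m - 2 * p * m / (p + q))) := by
  have h1 := h.floor_lt hm hm'
  have h2 := h.lt_floor_add_one m
  -- The two crossings coincide only when Pm is a half-integer, which the oddness of ω forbids.
  have hne : 2 * (slopeP p q * m) ≠ 2 * ((2 * p * m / (p + q) : ℤ) : ℝ) + 1 := by
    intro e
    rw [slopeP, div_mul_eq_mul_div, omega_eq_cast] at e
    have hw0 : ((p + q : ℤ) : ℝ) ≠ 0 := by rw [← omega_eq_cast]; exact h.omega_pos.ne'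
    field_simp at e
    have e' : 2 ^ 2 * p * m = (p + q) * (2 * (2 * p * m / (p + q)) + 1) := by exact_mod_cast e
    have ho : Odd ((p + q) * (2 * (2 * p * m / (p + q)) + 1)) :=
      h.odd_add.mul (odd_two_mul_add_one _)
    rw [← e'] at ho
    exact Int.not_even_iff_odd.2 ho ⟨2 * p * m, by ring⟩
  generalize 2 * p * m / (p + q) = f at *
  rw [GoodV]
  apply encard_two_points_eq_one_iff
    (x := ((m : ℝ), -slopeP p q * m + ((n + f + 1 : ℤ) : ℝ)))
    (y := ((m : ℝ), -slopeQ p q * m + ((n + 2 * m - f : ℤ) : ℝ)))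
  · intro e
    have e2 := congrArg Prod.snd e
    simp only [h.slopeQ_eq] at e2
    push_cast at e2
    apply hne
    linarith
  · rintro ⟨x, y⟩
    simp only [Set.mem_ofPred_eq, vSeg, Set.mem_prod, Set.mem_singleton_iff, Set.mem_Icc,
      Prod.mk.injEq]
    constructor
    · rintro ⟨⟨hx, hy1, hy2⟩, hl⟩
      obtain ⟨k, hk, hz | hz⟩ := (lightV_iff (z := (x, y)) hx).1 hl
      · have k1 : ((n + f : ℤ) : ℝ) < k := by simp only at hz; push_cast; linarith
        have k2 : (k : ℝ) < ((n + f + 2 : ℤ) : ℝ) := by simp only at hz; push_cast; linarith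
        have : k = n + f + 1 := by
          have := Int.cast_lt.1 k1
          have := Int.cast_lt.1 k2
          omega
        subst this
        exact .inl ⟨⟨hx, hz⟩, hk⟩
      · rw [h.slopeQ_eq] at hz
        have k1 : ((n + 2 * m - f - 1 : ℤ) : ℝ) < k := by
          simp only at hz; push_cast; linarith
        have k2 : (k : ℝ) < ((n + 2 * m - f + 1 : ℤ) : ℝ) := by
          simp only at hz; push_cast; linarith
        have : k = n + 2 * m - f := by
          have := Int.cast_lt.1 k1
          have := Int.cast_lt.1 k2
          omega
        subst this
        rw [h.slopeQ_eq]
        exact .inr ⟨⟨hx, hz⟩, hk⟩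
    · rintro (⟨⟨hx, hy⟩, hk⟩ | ⟨⟨hx, hy⟩, hk⟩)
      · refine ⟨⟨hx, ?_, ?_⟩, (lightV_iff (z := (x, y)) hx).2 ⟨_, hk, .inl hy⟩⟩ <;>
          push_cast at hy <;> linarith
      · refine ⟨⟨hx, ?_, ?_⟩, (lightV_iff (z := (x, y)) hx).2 ⟨_, hk, .inr hy⟩⟩ <;>
          rw [h.slopeQ_eq] at hy <;> push_cast at hy <;> linarith

lemma goodV_iff {m : ℤ} (n : ℤ) (hm : 0 ≤ m) (hm' : m < p + q) :
    GoodV p q m n ↔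
      ¬(LightIndex p q m (n + 2 * p * m / (p + q) + 1) ↔
        LightIndex p q m (n + 2 * m - 2 * p * m / (p + q))) := by
  rcases hm.lt_or_eq with hm | rfl
  · exact goodV_iff_of_pos h n hm hm'
  -- The line x = 0 has capacity 0, so both sides are false.
  · have hdark (k : ℤ) : ¬ LightIndex p q 0 k := by
      have h0 : mod2 (2 * slopeP p q * ((0 : ℤ) : ℝ)) = 0 := by norm_num [mod2]
      rw [LightIndex, h0]
      simp [LightValues]
    have : {z | z ∈ vSeg 0 n ∧ LightV p q z} = ∅ := by
      rw [Set.eq_empty_iff_forall_notMem]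
      rintro z ⟨⟨hz, -⟩, hl⟩
      obtain ⟨k, hk, -⟩ := (lightV_iff hz).1 hl
      exact hdark k hk
    simp [GoodV, this, hdark]

/-- A slanting line through the midpoint would make ω divide 2m + 1, which is smaller than ω. Hence
the double count plays no role here. -/
lemma not_lightH_hMid {m : ℤ} (n : ℤ) (hm : 0 ≤ m) (hm' : 2 * (m + 1) < p + q) :
    ¬ LightH p q (hMid m n) := by
  have hw0 : ((p + q : ℤ) : ℝ) ≠ 0 := by rw [← omega_eq_cast]; exact h.omega_pos.ne'
  intro hl
  obtain ⟨k, -, hk⟩ := (lightH_iff (z := hMid m n) rfl).1 hl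
  have key (r : ℤ) (hr : IsCoprime r (p + q))
      (e : (n : ℝ) = -(2 * r / omega p q) * ((m : ℝ) + 1 / 2) + k) : False := by
    rw [omega_eq_cast] at e
    have e1 : (r : ℝ) * (2 * m + 1) = ((p + q : ℤ) : ℝ) * (k - n) := by
      have : (k - n : ℝ) = 2 * r / ((p + q : ℤ) : ℝ) * ((m : ℝ) + 1 / 2) := by linarith
      rw [this]; field_simp
    have e2 : r * (2 * m + 1) = (p + q) * (k - n) := by exact_mod_cast e1
    have := Int.le_of_dvd (by omega) (hr.symm.dvd_of_dvd_mul_left (Dvd.intro _ e2.symm))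
    omega
  rcases hk with hk | hk
  · exact key p h.isCoprime_left hk
  · exact key q h.isCoprime_right hk

lemma goodH_iff_encard {m : ℤ} (n : ℤ) (hm : 0 ≤ m) (hm' : 2 * (m + 1) < p + q) :
    GoodH p q m n ↔ {z | z ∈ hSeg m n ∧ LightH p q z}.encard = 1 := by
  rw [GoodH, if_neg (not_lightH_hMid h n hm hm'), add_zero]

/-- When the floor does not jump, no P-line crosses the edge (except at the corner for m = 0), and
both candidates are on Q-lines. -/
lemma goodH_iff_of_floor_eq {m : ℤ} (n : ℤ) (hm : 0 ≤ m) (hm' : 2 * (m + 1) < p + q)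
    (hf : 2 * p * (m + 1) / (p + q) = 2 * p * m / (p + q)) :
    GoodH p q m n ↔
      ¬(LightIndex p q n (n + 2 * m - 2 * p * m / (p + q)) ↔
        LightIndex p q n (n + 2 * m + 1 - 2 * p * m / (p + q))) := by
  have h0 := h.floor_le m
  have h1 (hm : 0 < m) := h.floor_lt (m := m) hm (by omega)
  have hmf := h.floor_le_self hm
  have hf0 := h.floor_nonneg hm
  have h2 := h.lt_floor_add_one m
  have h3 := h.floor_lt (m := m + 1) (by omega) (by omega)
  have h4 := h.lt_floor_add_one (m + 1)
  have hQ := h.slopeQ_pos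
  have hP := h.slopeP_pos
  rw [hf] at h3 h4
  rw [goodH_iff_encard h n hm hm']
  generalize 2 * p * m / (p + q) = f at *
  push_cast at h3 h4
  apply encard_two_points_eq_one_iff
    (x := (((2 * m - f : ℤ) : ℝ) / slopeQ p q, (n : ℝ)))
    (y := (((2 * m + 1 - f : ℤ) : ℝ) / slopeQ p q, (n : ℝ)))
  · intro e
    have e2 := congrArg Prod.fst e
    simp only [div_left_inj' hQ.ne', Int.cast_inj] at e2
    omega
  · rintro ⟨x, y⟩
    simp only [Set.mem_ofPred_eq, hSeg, Set.mem_prod, Set.mem_singleton_iff, Set.mem_Icc,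
      Prod.mk.injEq]
    constructor
    · rintro ⟨⟨⟨hx1, hx2⟩, hy⟩, hl⟩
      obtain ⟨k, hk, hz | hz⟩ := (lightH_iff (z := (x, y)) hy).1 hl <;> simp only at hz
      · have x1 := mul_le_mul_of_nonneg_left hx1 hP.le
        have x2 := mul_le_mul_of_nonneg_left hx2 hP.le
        have k2 : (k : ℝ) < ((n + f + 1 : ℤ) : ℝ) := by push_cast; linarith
        have k2' := Int.cast_lt.1 k2
        rcases hm.lt_or_eq with hm | rfl
        · have k1 : ((n + f : ℤ) : ℝ) < k := by push_cast; linarith [h1 hm]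
          have k1' := Int.cast_lt.1 k1
          omega
        -- On x = 0 the P-line and the Q-line of intercept n meet with the same index, so this point
        -- is already the first Q-candidate.
        · have hf00 : f = 0 := by omega
          subst hf00
          have k1 : ((n : ℤ) : ℝ) ≤ k := by push_cast at *; linarith
          have k1' := Int.cast_le.1 k1
          have hkn : k = n := by omega
          subst hkn
          have hx0 : x = 0 := by
            have : slopeP p q * x = 0 := by linarith
            exact (mul_eq_zero.1 this).resolve_left hP.ne'
          left
          refine ⟨⟨?_, hy⟩, by simpa using hk⟩
          simp [hx0]
      · have x1 := mul_le_mul_of_nonneg_left hx1 hQ.le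
        have x2 := mul_le_mul_of_nonneg_left hx2 hQ.le
        have hzx : x = (k - n) / slopeQ p q := by field_simp; linarith
        rw [h.slopeQ_eq] at hz x1 x2
        have k1 : ((n + 2 * m - f - 1 : ℤ) : ℝ) < k := by push_cast; linarith
        have k2 : (k : ℝ) < ((n + 2 * m - f + 2 : ℤ) : ℝ) := by push_cast; linarith
        have k1' := Int.cast_lt.1 k1
        have k2' := Int.cast_lt.1 k2
        rcases (by omega : k = n + 2 * m - f ∨ k = n + 2 * m + 1 - f) with rfl | rfl
        · exact .inl ⟨⟨by rw [hzx]; push_cast; ring, hy⟩, hk⟩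
        · exact .inr ⟨⟨by rw [hzx]; push_cast; ring, hy⟩, hk⟩
    · rintro (⟨⟨hx, hy⟩, hk⟩ | ⟨⟨hx, hy⟩, hk⟩)
      · refine ⟨⟨⟨?_, ?_⟩, hy⟩, (lightH_iff (z := (x, y)) hy).2 ⟨_, hk, .inr ?_⟩⟩
        · rw [hx, le_div_iff₀ hQ, h.slopeQ_eq]; push_cast; linarith
        · rw [hx, div_le_iff₀ hQ, h.slopeQ_eq]; push_cast; linarith
        · simp only [hx]; field_simp; push_cast; ring
      · refine ⟨⟨⟨?_, ?_⟩, hy⟩, (lightH_iff (z := (x, y)) hy).2 ⟨_, hk, .inr ?_⟩⟩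
        · rw [hx, le_div_iff₀ hQ, h.slopeQ_eq]; push_cast; linarith
        · rw [hx, div_le_iff₀ hQ, h.slopeQ_eq]; push_cast; linarith
        · simp only [hx]; field_simp; push_cast; ring

/-- When the floor jumps, the edge is crossed by one P-line and one Q-line. -/
lemma goodH_iff_of_floor_eq_add_one {m : ℤ} (n : ℤ) (hm : 0 ≤ m) (hm' : 2 * (m + 1) < p + q)
    (hf : 2 * p * (m + 1) / (p + q) = 2 * p * m / (p + q) + 1) :
    GoodH p q m n ↔
      ¬(LightIndex p q n (n + 2 * p * m / (p + q) + 1) ↔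
        LightIndex p q n (n + 2 * m - 2 * p * m / (p + q))) := by
  have h3 := h.floor_lt (m := m + 1) (by omega) (by omega)
  have h4 := h.lt_floor_add_one (m + 1)
  have hQ := h.slopeQ_pos
  have hP := h.slopeP_pos
  have hP1 := h.slopeP_lt_one
  have hm0 : 0 < m := by
    rcases hm.lt_or_eq with hm | rfl
    · exact hm
    · rw [hf] at h3
      simp only [mul_zero, Int.zero_ediv] at h3
      push_cast at h3
      linarith
  have h1 := h.floor_lt (m := m) hm0 (by omega)
  have h2 := h.lt_floor_add_one m
  rw [hf] at h3 h4
  rw [goodH_iff_encard h n hm hm']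
  generalize 2 * p * m / (p + q) = f at *
  push_cast at h3 h4
  apply encard_two_points_eq_one_iff
    (x := (((f + 1 : ℤ) : ℝ) / slopeP p q, (n : ℝ)))
    (y := (((2 * m - f : ℤ) : ℝ) / slopeQ p q, (n : ℝ)))
  · intro e
    have e2 := congrArg Prod.fst e
    simp only [div_eq_div_iff hP.ne' hQ.ne'] at e2
    rw [slopeP, slopeQ, mul_div_assoc', mul_div_assoc', div_left_inj' h.omega_pos.ne'] at e2
    have e3 : (f + 1) * (2 * q) = (2 * m - f) * (2 * p) := by exact_mod_cast e2
    -- If the two crossings coincided, ω would divide 2m + 1.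
    have hd : (p + q) ∣ p * (2 * m + 1) := ⟨f + 1, by linarith⟩
    exact h.not_dvd_mul (by omega) (by omega) hd
  · rintro ⟨x, y⟩
    simp only [Set.mem_ofPred_eq, hSeg, Set.mem_prod, Set.mem_singleton_iff, Set.mem_Icc,
      Prod.mk.injEq]
    constructor
    · rintro ⟨⟨⟨hx1, hx2⟩, hy⟩, hl⟩
      obtain ⟨k, hk, hz | hz⟩ := (lightH_iff (z := (x, y)) hy).1 hl <;> simp only at hz
      · have x1 := mul_le_mul_of_nonneg_left hx1 hP.le
        have x2 := mul_le_mul_of_nonneg_left hx2 hP.le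
        have hzx : x = (k - n) / slopeP p q := by field_simp; linarith
        have k1 : ((n + f : ℤ) : ℝ) < k := by push_cast; linarith
        have k2 : (k : ℝ) < ((n + f + 2 : ℤ) : ℝ) := by push_cast; linarith
        have k1' := Int.cast_lt.1 k1
        have k2' := Int.cast_lt.1 k2
        have hkk : k = n + f + 1 := by omega
        subst hkk
        exact .inl ⟨⟨by rw [hzx]; push_cast; ring, hy⟩, hk⟩
      · have x1 := mul_le_mul_of_nonneg_left hx1 hQ.le
        have x2 := mul_le_mul_of_nonneg_left hx2 hQ.le
        have hzx : x = (k - n) / slopeQ p q := by field_simp; linarith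
        rw [h.slopeQ_eq] at hz x1 x2
        have k1 : ((n + 2 * m - f - 1 : ℤ) : ℝ) < k := by push_cast; linarith
        have k2 : (k : ℝ) < ((n + 2 * m - f + 1 : ℤ) : ℝ) := by push_cast; linarith
        have k1' := Int.cast_lt.1 k1
        have k2' := Int.cast_lt.1 k2
        have hkk : k = n + 2 * m - f := by omega
        subst hkk
        exact .inr ⟨⟨by rw [hzx]; push_cast; ring, hy⟩, hk⟩
    · rintro (⟨⟨hx, hy⟩, hk⟩ | ⟨⟨hx, hy⟩, hk⟩)
      · refine ⟨⟨⟨?_, ?_⟩, hy⟩, (lightH_iff (z := (x, y)) hy).2 ⟨_, hk, .inl ?_⟩⟩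
        · rw [hx, le_div_iff₀ hP]; push_cast; linarith
        · rw [hx, div_le_iff₀ hP]; push_cast; linarith
        · simp only [hx]; field_simp; push_cast; ring
      · refine ⟨⟨⟨?_, ?_⟩, hy⟩, (lightH_iff (z := (x, y)) hy).2 ⟨_, hk, .inr ?_⟩⟩
        · rw [hx, le_div_iff₀ hQ, h.slopeQ_eq]; push_cast; linarith
        · rw [hx, div_le_iff₀ hQ, h.slopeQ_eq]; push_cast; linarith
        · simp only [hx]; field_simp; push_cast; ring

end Good

/-! ## Comparison of the good edges -/

section Core

variable {a b p' q' κ p q : ℤ} (h : IsCore a b p' q' κ p q)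
include h

lemma IsCore.nearest_sub_vertical {j m : ℤ}
    (h1 : |2 * j - (a + b)| < 2 * (a + b) + (p' + q'))
    (h2 : |2 * (j - 2 * m) - (a + b)| < 2 * (a + b) + (p' + q')) :
    nearest p q (j + κ * (p' + q')) - nearest p q (j + κ * (p' + q') - 2 * m) =
      nearest a b j - nearest a b (j - 2 * m) := by
  rw [show j + κ * (p' + q') - 2 * m = j - 2 * m + κ * (p' + q') by ring,
    h.nearest_add h1, h.nearest_add h2]
  ring

/-- Here the line index shifts too, so k - 2n moves by -κω'. Oddness of `nearest` brings it back
into range, and the contributions add up to the even number 2κp' instead of cancelling. -/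
lemma IsCore.nearest_sub_horizontal {j n : ℤ}
    (h1 : |2 * j - (a + b)| < 2 * (a + b) + (p' + q'))
    (h2 : |2 * (2 * n - j) - (a + b)| < 2 * (a + b) + (p' + q')) :
    nearest p q (j + κ * (p' + q')) -
        nearest p q (j + κ * (p' + q') - 2 * (n + κ * (p' + q'))) =
      nearest a b j - nearest a b (j - 2 * n) + 2 * (κ * p') := by
  rw [show j + κ * (p' + q') - 2 * (n + κ * (p' + q')) = -(2 * n - j + κ * (p' + q')) by ring,
    show j - 2 * n = -(2 * n - j) by ring, nearest_neg h.param, nearest_neg h.core,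
    h.nearest_add h1, h.nearest_add h2]
  ring

lemma IsCore.le_add : a + b ≤ p + q := by
  have := h.add_eq
  have := mul_nonneg h.kappa_nonneg (by have := h.lt; have := h.lt_three; omega : 0 ≤ p' + q')
  linarith

/-- The bound on m together with ω̂ < 3ω' keeps both intercepts, and their shifts by 2m, in the
range of `IsCore.nearest_add`. -/
lemma IsCore.goodV_iff {m n : ℤ} (hm : 0 ≤ m) (hm' : 2 * m ≤ (a + b) - (p' + q')) (hn : 0 ≤ n)
    (hn' : n < a + b) : GoodV p q m (n + κ * (p' + q')) ↔ GoodV a b m n := by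
  have hw := h.core.three_le
  have hlt := h.lt
  have hlt3 := h.lt_three
  have hle := h.le_add
  rw [Plaid.goodV_iff h.param _ hm (by omega), Plaid.goodV_iff h.core _ hm (by omega),
    not_lightIndex_iff h.param, not_lightIndex_iff h.core, h.floor_eq hm (by omega)]
  have f0 := h.core.floor_nonneg hm
  have f1 := h.core.floor_le_self hm
  generalize 2 * a * m / (a + b) = f at *
  rw [show n + κ * (p' + q') + f + 1 = n + f + 1 + κ * (p' + q') by ring,
    show n + κ * (p' + q') + 2 * m - f = n + 2 * m - f + κ * (p' + q') by ring,
    h.nearest_sub_vertical, h.nearest_sub_vertical] <;> rw [abs_lt] <;> omega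

lemma IsCore.goodH_iff {m n : ℤ} (hm : 0 ≤ m) (hm' : 2 * (m + 1) ≤ (a + b) - (p' + q'))
    (hn : 0 ≤ n) (hn' : n ≤ a + b) : GoodH p q m (n + κ * (p' + q')) ↔ GoodH a b m n := by
  have hw := h.core.three_le
  have hlt := h.lt
  have hlt3 := h.lt_three
  have hle := h.le_add
  have hfm := h.floor_eq hm (by omega)
  have hfm' := h.floor_eq (m := m + 1) (by omega) (by omega)
  have f0 := h.core.floor_nonneg hm
  have f1 := h.core.floor_le_self hm
  have parity (x y c : ℤ) : Odd (x + 2 * c + (y + 2 * c)) ↔ Odd (x + y) := by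
    simp only [Int.odd_iff]; omega
  rcases h.core.floor_succ m with hf | hf
  · rw [goodH_iff_of_floor_eq h.param _ hm (by omega) (by rw [hfm, hfm', hf]),
      goodH_iff_of_floor_eq h.core _ hm (by omega) hf,
      not_lightIndex_iff h.param, not_lightIndex_iff h.core, hfm]
    generalize 2 * a * m / (a + b) = f at *
    rw [show n + κ * (p' + q') + 2 * m - f = n + 2 * m - f + κ * (p' + q') by ring,
      show n + κ * (p' + q') + 2 * m + 1 - f = n + 2 * m + 1 - f + κ * (p' + q') by ring,
      h.nearest_sub_horizontal, h.nearest_sub_horizontal, parity] <;> rw [abs_lt] <;> omega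
  · rw [goodH_iff_of_floor_eq_add_one h.param _ hm (by omega) (by rw [hfm, hfm', hf]),
      goodH_iff_of_floor_eq_add_one h.core _ hm (by omega) hf,
      not_lightIndex_iff h.param, not_lightIndex_iff h.core, hfm]
    generalize 2 * a * m / (a + b) = f at *
    rw [show n + κ * (p' + q') + f + 1 = n + f + 1 + κ * (p' + q') by ring,
      show n + κ * (p' + q') + 2 * m - f = n + 2 * m - f + κ * (p' + q') by ring,
      h.nearest_sub_horizontal, h.nearest_sub_horizontal, parity] <;> rw [abs_lt] <;> omega

end Core

/-! ## Comparison of the tilings -/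

lemma mem_segment_vertical {x y₁ y₂ : ℝ} {z : ℝ × ℝ} :
    z ∈ segment ℝ (x, y₁) (x, y₂) ↔ z.1 = x ∧ z.2 ∈ Set.uIcc y₁ y₂ := by
  rw [← Prod.image_mk_segment_right, segment_eq_uIcc]
  constructor
  · rintro ⟨y, hy, rfl⟩
    exact ⟨rfl, hy⟩
  · rintro ⟨rfl, hy⟩
    exact ⟨z.2, hy, rfl⟩

lemma mem_segment_horizontal {x₁ x₂ y : ℝ} {z : ℝ × ℝ} :
    z ∈ segment ℝ (x₁, y) (x₂, y) ↔ z.2 = y ∧ z.1 ∈ Set.uIcc x₁ x₂ := by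
  rw [← Prod.image_mk_segment_left, segment_eq_uIcc]
  constructor
  · rintro ⟨x, hx, rfl⟩
    exact ⟨rfl, hx⟩
  · rintro ⟨rfl, hx⟩
    exact ⟨z.1, hx, rfl⟩

lemma mem_tile_iff {p q m n : ℤ} {z : ℝ × ℝ} :
    z ∈ tile p q m n ↔
      (GoodH p q m n ∧ z.1 = m + 1 / 2 ∧ n ≤ z.2 ∧ z.2 ≤ n + 1 / 2) ∨
      (GoodH p q m (n + 1) ∧ z.1 = m + 1 / 2 ∧ n + 1 / 2 ≤ z.2 ∧ z.2 ≤ n + 1) ∨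
      (GoodV p q m n ∧ z.2 = n + 1 / 2 ∧ m ≤ z.1 ∧ z.1 ≤ m + 1 / 2) ∨
      (GoodV p q (m + 1) n ∧ z.2 = n + 1 / 2 ∧ m + 1 / 2 ≤ z.1 ∧ z.1 ≤ m + 1) := by
  have lo (x : ℝ) : Set.uIcc (x + 1 / 2) x = Set.Icc x (x + 1 / 2) :=
    Set.uIcc_of_ge (by linarith)
  have hi (x : ℝ) : Set.uIcc (x + 1 / 2) (x + 1) = Set.Icc (x + 1 / 2) (x + 1) :=
    Set.uIcc_of_le (by linarith)
  rw [tile, Set.mem_ofPred_eq]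
  simp only [squareCenter, hMid, vMid, mem_segment_vertical, mem_segment_horizontal,
    Int.cast_add, Int.cast_one, lo, hi, Set.mem_Icc]

lemma IsCore.mem_tile_iff {a b p' q' κ p q : ℤ} (h : IsCore a b p' q' κ p q) {z : ℝ × ℝ}
    (hz : z ∈ box a b) (m n : ℤ) :
    vTranslate ((κ * (p' + q') : ℤ) : ℝ) z ∈ tile p q m (n + κ * (p' + q')) ↔
      z ∈ tile a b m n := by
  have hW := h.two_mul_boxWidth_le
  obtain ⟨⟨x1, x2⟩, y1, y2⟩ := hz
  have x2' : z.1 ≤ ((boxWidth a b : ℤ) : ℝ) := by exact_mod_cast x2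
  rw [omega_eq_cast] at y2
  generalize (boxWidth a b : ℤ) = W at *
  have of_le {i j : ℤ} (hij : (i : ℝ) < j + 1) : i ≤ j := by
    have : (i : ℝ) < ((j + 1 : ℤ) : ℝ) := by push_cast; exact hij
    exact Int.lt_add_one_iff.1 (Int.cast_lt.1 this)
  have of_lt {i j : ℤ} (hij : (i : ℝ) < j) : i < j := Int.cast_lt.1 hij
  rw [Plaid.mem_tile_iff, Plaid.mem_tile_iff]
  simp only [vTranslate]
  rw [show n + κ * (p' + q') + 1 = n + 1 + κ * (p' + q') by ring]
  have shift (t : ℤ) : ((n + t : ℤ) : ℝ) = n + t := by push_cast; rfl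
  rw [shift]
  generalize ((κ * (p' + q') : ℤ) : ℝ) = T
  refine or_congr ?_ (or_congr ?_ (or_congr ?_ ?_))
  · rw [show n + T + 1 / 2 = n + 1 / 2 + T by ring]
    simp only [add_le_add_iff_right]
    -- Goodness is compared only when the half-segment contains a point of the box, which bounds m
    -- and n.
    refine and_congr_left fun ⟨e, l, u⟩ ↦ ?_
    have : 0 ≤ m := of_le (by push_cast; linarith)
    have : m < W := of_lt (by linarith)
    have : 0 ≤ n := of_le (by push_cast; linarith)
    have : n ≤ a + b := of_le (by linarith)
    exact h.goodH_iff (by omega) (by omega) (by omega) (by omega)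
  · rw [show n + T + 1 / 2 = n + 1 / 2 + T by ring, show n + T + 1 = n + 1 + T by ring]
    simp only [add_le_add_iff_right]
    refine and_congr_left fun ⟨e, l, u⟩ ↦ ?_
    have : 0 ≤ m := of_le (by push_cast; linarith)
    have : m < W := of_lt (by linarith)
    have : 0 ≤ n + 1 := of_le (by push_cast; linarith)
    have : n < a + b := of_lt (by linarith)
    exact h.goodH_iff (by omega) (by omega) (by omega) (by omega)
  · rw [show n + T + 1 / 2 = n + 1 / 2 + T by ring]
    simp only [add_left_inj]
    refine and_congr_left fun ⟨e, l, u⟩ ↦ ?_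
    have : 0 ≤ m := of_le (by push_cast; linarith)
    have : m ≤ W := of_le (by linarith)
    have : 0 ≤ n := of_le (by push_cast; linarith)
    have : n < a + b := of_lt (by linarith)
    exact h.goodV_iff (by omega) (by omega) (by omega) (by omega)
  · rw [show n + T + 1 / 2 = n + 1 / 2 + T by ring]
    simp only [add_left_inj]
    refine and_congr_left fun ⟨e, l, u⟩ ↦ ?_
    -- The edge concerned is on x = m + 1, so m = -1 is allowed.
    have : -1 ≤ m := of_le (by push_cast; linarith)
    have : m < W := of_lt (by linarith)
    have : 0 ≤ n := of_le (by push_cast; linarith)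
    have : n < a + b := of_lt (by linarith)
    exact h.goodV_iff (by omega) (by omega) (by omega) (by omega)

lemma IsCore.half_omega_sub {a b p' q' κ p q : ℤ} (h : IsCore a b p' q' κ p q) :
    (omega p q - omega a b) / 2 = ((κ * (p' + q') : ℤ) : ℝ) := by
  rw [omega_eq_cast, omega_eq_cast, h.add_eq]
  push_cast
  ring

end Plaid

theorem mainTheorem4 (p q κ phat qhat : ℤ)
    (hpq : Plaid.IsEvenParameter p q) (hκ : 1 ≤ κ)
    (hcore : Plaid.IsCorePredecessor phat qhat p q κ) :
    (Plaid.vTranslate ((Plaid.omega p q - Plaid.omega phat qhat) / 2) '' Plaid.box phat qhat) ∩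
        Plaid.plaidTiling p q =
      Plaid.vTranslate ((Plaid.omega p q - Plaid.omega phat qhat) / 2) ''
        (Plaid.box phat qhat ∩ Plaid.plaidTiling phat qhat) := by
  obtain ⟨p', q', h⟩ := hcore.exists_isCore
  rw [h.half_omega_sub]
  ext z
  simp only [Plaid.plaidTiling, Set.mem_inter_iff, Set.mem_image, Set.mem_iUnion]
  constructor
  · rintro ⟨⟨w, hw, rfl⟩, m, n, hz⟩
    refine ⟨w, ⟨hw, m, n - κ * (p' + q'), ?_⟩, rfl⟩
    rw [← h.mem_tile_iff hw, sub_add_cancel]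
    exact hz
  · rintro ⟨w, ⟨hw, m, n, hz⟩, rfl⟩
    exact ⟨⟨w, hw, rfl⟩, m, n + κ * (p' + q'), (h.mem_tile_iff hw m n).2 hz⟩
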